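/- Let $A\in\{0,\star\}^{d\times d}$ and $B\in\{0,\star\}^{d\times m}$ be sparsity matrices. A pair $(A,B)$ is \emph{structurally controllable} if real values can be assigned to the $\star$ entries of $A$ and $B$ (all other entries being $0$) so that the linear system $\dot x=A'x+B'u$ with the resulting matrices $(A',B')$ is controllable. Assume that $(A,B)$ is structurally controllable, and let each $\star$ entry $B_{ik}$ carry a cost $w_{ik}\ge 0$; put $w_{ik}=\infty$ if $B_{ik}=0$. Let $G(A)$ be the digraph on $\{v_1,\dots,v_d\}$ with an edge $(v_j,v_i)$ whenever $A_{ij}=\star$, and let $\Gamma(A)$ be the undirected bipartite graph with parts $\{v^1_1,\dots,v^1_d\}$ and $\{v^2_1,\dots,v^2_d\}$ and an edge $\{v^1_j,v^2_i\}$ whenever $A_{ij}=\star$. Assume that $\Gamma(A)$ has a perfect matching. Consider the following algorithm. List the source strongly connected components $\mathcal S_1,\dots,\mathcal S_q$ of $G(A)$ (the strongly connected components that no edge enters from outside), and start with $L=\emptyset$. For each $\mathcal S_j$ in turn: for each $v_i\in\mathcal S_j$ choose a smallest cost $w_{ik}$ among $w_{i1},\dots,w_{im}$; then choose $v_\ell\in\mathcal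 S_j$ for which this smallest cost, say $w_{\ell k}$, is least, and add $(\ell,k)$ to $L$. Output $B^*\in\{0,\star\}^{d\times m}$ with $B^*_{\ell k}=\star$ if $(\ell,k)\in L$ and $B^*_{\ell k}=0$ otherwise. Ties and the order of the components are arbitrary. Let $\mathcal K$ be the set of all $B'\in\{0,\star\}^{d\times m}$ such that $B'_{ik}=0$ whenever $B_{ik}=0$ and $(A,B')$ is structurally controllable. Write $\|B'\|_0$ for the number of $\star$ entries of $B'$ and $\|B'\|_w=\sum_{(i,k):\,B'_{ik}=\star}w_{ik}$. Then the algorithm yields an output, and for every possible output $B^*$ the pair $(A,B^*)$ is structurally controllable and $B^*$ solves $$\min_{B'\in\mathcal K}\ \|B'\|_w\quad\text{subject to}\quad \|B'\|_0\le\|B''\|_0\ \text{ for all } B''\in\mathcal K,$$ that is, $B^*\in\mathcal K$, $B^*$ has the fewest $\star$ entries among all elements of $\mathcal K$, and it has minimum cost among all such sparsest elements. -/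

import Mathlib

namespace StructuralControl

/-- Sparsity matrices with entries in `{0, ⋆}`: the value `true` stands for a free entry `⋆`,
the value `false` for a fixed zero. -/
abbrev Sparsity (n k : ℕ) : Type := Matrix (Fin n) (Fin k) Bool

/-- `R` is a numerical realization of the sparsity matrix `N`: it vanishes at all fixed zeros,
and its values at the `⋆` entries are arbitrary real numbers. -/
def IsRealization {n k : ℕ} (N : Sparsity n k) (R : Matrix (Fin n) (Fin k) ℝ) : Prop :=
  ∀ i j, N i j = false → R i j = 0

/-- `x` is a trajectory of `x' = A x + B u` on the time interval `[0, T]`. -/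
def IsTrajectory {d m : ℕ} (A : Matrix (Fin d) (Fin d) ℝ) (B : Matrix (Fin d) (Fin m) ℝ)
    (T : ℝ) (u : ℝ → Fin m → ℝ) (x : ℝ → Fin d → ℝ) : Prop :=
  ∀ t ∈ Set.Icc 0 T,
    HasDerivWithinAt x (A.mulVec (x t) + B.mulVec (u t)) (Set.Icc 0 T) t

/-- Controllability of the linear time-invariant system `x' = A x + B u`: every initial state
can be steered to every final state in finite time by some continuous input. -/
def Controllable {d m : ℕ} (A : Matrix (Fin d) (Fin d) ℝ) (B : Matrix (Fin d) (Fin m) ℝ) : Prop :=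
  ∀ x₀ x₁ : Fin d → ℝ, ∃ T : ℝ, 0 < T ∧ ∃ (u : ℝ → Fin m → ℝ) (x : ℝ → Fin d → ℝ),
    ContinuousOn u (Set.Icc 0 T) ∧ IsTrajectory A B T u x ∧ x 0 = x₀ ∧ x T = x₁

/-- Structural controllability: some numerical realization is controllable. -/
def StructurallyControllable {d m : ℕ} (A : Sparsity d d) (B : Sparsity d m) : Prop :=
  ∃ (RA : Matrix (Fin d) (Fin d) ℝ) (RB : Matrix (Fin d) (Fin m) ℝ),
    IsRealization A RA ∧ IsRealization B RB ∧ Controllable RA RB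

/-- The digraph `G(A)` on the state vertices, with an edge from `j` to `i` iff `A i j = ⋆`. -/
def stateDigraph {d : ℕ} (A : Sparsity d d) : Digraph (Fin d) where
  Adj j i := A i j = true

/-- The subgraph of `G` induced on the vertex set `S` is strongly connected (every vertex of `S`
is joined to every vertex of `S` by a directed path inside `S`, possibly of length zero). -/
def IsStronglyConnectedOn {V : Type*} (G : Digraph V) (S : Finset V) : Prop :=
  ∀ a ∈ S, ∀ b ∈ S, Relation.ReflTransGen (fun p q => p ∈ S ∧ q ∈ S ∧ G.Adj p q) a b

/-- Strongly connected components, given by their vertex sets. -/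
def IsSCC {V : Type*} (G : Digraph V) (S : Finset V) : Prop :=
  Maximal (fun T : Finset V => T.Nonempty ∧ IsStronglyConnectedOn G T) S

/-- Source strongly connected components: no edge enters from outside. -/
def IsSourceSCC {V : Type*} (G : Digraph V) (S : Finset V) : Prop :=
  IsSCC G S ∧ ∀ a, a ∉ S → ∀ b ∈ S, ¬ G.Adj a b

/-- The undirected bipartite graph `Γ(A)`: the left copy of the state `j` is joined to the right
copy of the state `i` iff `A i j = ⋆`. -/
def bipartiteGraph {d : ℕ} (A : Sparsity d d) : SimpleGraph (Fin d ⊕ Fin d) :=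
  SimpleGraph.fromRel fun p q => ∃ i j, A i j = true ∧ p = Sum.inl j ∧ q = Sum.inr i

/-- `Γ(A)` has a perfect matching. -/
def HasPerfectMatching {d : ℕ} (A : Sparsity d d) : Prop :=
  ∃ M : (bipartiteGraph A).Subgraph, M.IsPerfectMatching

/-- The number of nonzero entries of a sparsity matrix. -/
def nnzCount {n k : ℕ} (N : Sparsity n k) : ℕ :=
  ∑ i, ∑ j, if N i j = true then 1 else 0

/-- The total cost of the nonzero entries of a sparsity matrix. -/
noncomputable def totalCost {n k : ℕ} (w : Matrix (Fin n) (Fin k) ℝ) (N : Sparsity n k) : ℝ :=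
  ∑ i, ∑ j, if N i j = true then w i j else 0

/-- The set of admissible input matrices: those whose zeros include all zeros of `B`
and that make the pair with `A` structurally controllable. -/
def admissible {d m : ℕ} (A : Sparsity d d) (B : Sparsity d m) : Set (Sparsity d m) :=
  {N | (∀ i j, B i j = false → N i j = false) ∧ StructurallyControllable A N}

/-- The admissible input matrices with the least number of nonzero entries. -/
def sparsestAdmissible {d m : ℕ} (A : Sparsity d d) (B : Sparsity d m) : Set (Sparsity d m) :=
  {N | N ∈ admissible A B ∧ ∀ N₂ ∈ admissible A B, nnzCount N ≤ nnzCount N₂}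

/-- `N` has minimum cost among the sparsest admissible input matrices. -/
def SolvesP2 {d m : ℕ} (A : Sparsity d d) (B : Sparsity d m) (w : Matrix (Fin d) (Fin m) ℝ)
    (N : Sparsity d m) : Prop :=
  N ∈ sparsestAdmissible A B ∧ ∀ N₂ ∈ sparsestAdmissible A B, totalCost w N ≤ totalCost w N₂

/-- The costs seen by the algorithm: `∞` for the input-connections that are absent from `B`. -/
noncomputable def extCost {d m : ℕ} (B : Sparsity d m) (w : Matrix (Fin d) (Fin m) ℝ)
    (i : Fin d) (k : Fin m) : WithTop ℝ :=
  if B i k = true then (w i k : WithTop ℝ) else ⊤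

/-- One pass of the loop body on the component `S` may select the connection from the input `k`
to the state `l`: for each state `i ∈ S` a cheapest input `best i` is chosen, and then a state
`l ∈ S` for which this smallest cost is least; ties are broken arbitrarily. -/
def Selects {d m : ℕ} (B : Sparsity d m) (w : Matrix (Fin d) (Fin m) ℝ) (S : Finset (Fin d))
    (k : Fin m) (l : Fin d) : Prop :=
  ∃ best : Fin d → Fin m,
    (∀ i ∈ S, ∀ k₂, extCost B w i (best i) ≤ extCost B w i k₂) ∧
    l ∈ S ∧ (∀ i ∈ S, extCost B w l (best l) ≤ extCost B w i (best i)) ∧ k = best l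

/-- `LoopRun B w comps L L₂`: the loop over the components `comps`, started with the set `L` of
input-connections, may end with the set `L₂`. -/
inductive LoopRun {d m : ℕ} (B : Sparsity d m) (w : Matrix (Fin d) (Fin m) ℝ) :
    List (Finset (Fin d)) → Finset (Fin m × Fin d) → Finset (Fin m × Fin d) → Prop
  | done (L : Finset (Fin m × Fin d)) : LoopRun B w [] L L
  | step (S : Finset (Fin d)) (comps : List (Finset (Fin d))) (k : Fin m) (l : Fin d)
      (L L₂ : Finset (Fin m × Fin d)) (hsel : Selects B w S k l)
      (hrun : LoopRun B w comps (insert (k, l) L) L₂) : LoopRun B w (S :: comps) L L₂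

/-- `N` is a possible output of the greedy algorithm on the input `A`, `B`, `w`: the source
strongly connected components of `G(A)` are listed in some order, the loop is run on this list
starting with the empty set, and `N` has its `⋆` entries at the selected connections. -/
def IsAlgorithmOutput {d m : ℕ} (A : Sparsity d d) (B : Sparsity d m)
    (w : Matrix (Fin d) (Fin m) ℝ) (N : Sparsity d m) : Prop :=
  ∃ (comps : List (Finset (Fin d))) (L : Finset (Fin m × Fin d)),
    comps.Nodup ∧ (∀ S, S ∈ comps ↔ IsSourceSCC (stateDigraph A) S) ∧
    LoopRun B w comps ∅ L ∧ ∀ l k, N l k = true ↔ (k, l) ∈ L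

end StructuralControl

/-!
A perfect matching of `Γ(A)` is a permutation `σ` of the states along the edges of `G(A)`, so the
states are partitioned into cycles. If each source component of `G(A)` receives an input, then the
cycles can be arranged in a forest, each cycle hanging from an input or from a state of its parent
cycle. Give the edges of the cycle `q` the weight `c q`, the edges of the forest the weight `1` and
all other entries the value `0`. If a left eigenvector `v` for the eigenvalue `μ` vanishes on all
children of the cycle `q` but not on `q`, then `c q ^ N = μ ^ N`, where `N` is the order of `σ`:
follow `v` around the cycle. When these powers are distinct, at most one cycle resonates with `μ`
in this way, so `v` lives on a chain of ancestors of this cycle. If moreover the inputs annihilate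
`v`, then `v` vanishes on the topmost cycle of the chain: it vanishes at the entry, and this
propagates around the cycle, since at most one of its states carries the next cycle of the chain.
Hence `v = 0`, and the Hautus test gives controllability.

Conversely, without an input a source component can never leave the state zero. So the admissible
input matrices are those with a `⋆` entry in each source component. As source components are
disjoint, the sparsest ones have exactly one such entry per component, and their cost is a sum over
the components, which the algorithm minimizes term by term.
-/

namespace StructuralControl

open Relation Set
open scoped Matrix

section SteeringOperators

variable {E U : Type*} [NormedAddCommGroup E] [NormedSpace ℝ E] [NormedAddCommGroup U]
  [NormedSpace ℝ U]

theorem exp_smul_apply_exp_smul_neg_apply [CompleteSpace E] (L : E →L[ℝ] E) (t : ℝ) (x : E) :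
    NormedSpace.exp (t • L) (NormedSpace.exp (t • -L) x) = x := by
  let _ : NormedAlgebra ℚ (E →L[ℝ] E) := NormedAlgebra.restrictScalars ℚ ℝ _
  have hcomm : Commute (t • L) (t • -L) := ((Commute.refl L).neg_right.smul_left t).smul_right t
  have hmul : NormedSpace.exp (t • L) * NormedSpace.exp (t • -L) = 1 := by
    rw [← NormedSpace.exp_add_of_commute hcomm, smul_neg, add_neg_cancel, NormedSpace.exp_zero]
  exact DFunLike.congr_fun hmul x

theorem continuous_exp_smul_apply [CompleteSpace E] (L : E →L[ℝ] E) {y : ℝ → E}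
    (hy : Continuous y) : Continuous fun t : ℝ => NormedSpace.exp (t • L) (y t) :=
  (continuous_iff_continuousAt.2 fun t =>
    (hasDerivAt_exp_smul_const (𝕂 := ℝ) L t).continuousAt).clm_apply hy

theorem hasDerivAt_variation_of_constants [CompleteSpace E] (L : E →L[ℝ] E) {y : ℝ → E}
    (hy : Continuous y) (x₀ : E) (t : ℝ) :
    HasDerivAt
      (fun t => NormedSpace.exp (t • L) (x₀ + ∫ s in (0 : ℝ)..t, NormedSpace.exp (s • -L) (y s)))
      (L (NormedSpace.exp (t • L) (x₀ + ∫ s in (0 : ℝ)..t, NormedSpace.exp (s • -L) (y s))) + y t)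
      t := by
  have hint := ((continuous_exp_smul_apply (-L) hy).integral_hasStrictDerivAt 0 t).hasDerivAt
  have hexp := (hasDerivAt_exp_smul_const' (𝕂 := ℝ) L t).clm_apply (hint.const_add x₀)
  rwa [exp_smul_apply_exp_smul_neg_apply] at hexp

theorem apply_pow_apply_eq_zero_of_apply_exp_smul [CompleteSpace E] {F : Type*}
    [NormedAddCommGroup F] [NormedSpace ℝ F] {T : ℝ} (hT : 0 < T) (L : E →L[ℝ] E) (f : E →L[ℝ] F)
    (x : E)
    (h : ∀ s ∈ Icc 0 T, f (NormedSpace.exp (s • L) x) = 0) (n : ℕ) : f ((L ^ n) x) = 0 := by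
  suffices hn : ∀ s ∈ Icc 0 T, f (NormedSpace.exp (s • L) ((L ^ n) x)) = 0 by
    simpa using hn 0 ⟨le_rfl, hT.le⟩
  induction n with
  | zero => simpa using h
  | succ n ih =>
    intro s hs
    have hexp := (hasDerivAt_exp_smul_const (𝕂 := ℝ) L s).clm_apply
      (hasDerivAt_const s ((L ^ n) x))
    have hderiv := (f.hasFDerivAt.comp_hasDerivAt s hexp).hasDerivWithinAt (s := Icc 0 T)
    have hzero : HasDerivWithinAt (fun s => f (NormedSpace.exp (s • L) ((L ^ n) x))) 0
        (Icc 0 T) s := (hasDerivWithinAt_const _ _ _).congr ih (ih s hs)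
    simpa [pow_succ'] using (uniqueDiffOn_Icc hT s hs).eq_deriv _ hderiv hzero

theorem eq_zero_of_integral_mul_self_eq_zero {φ : ℝ → ℝ} (hφ : Continuous φ) {a b : ℝ}
    (hab : a < b) (h : ∫ s in a..b, φ s * φ s = 0) : ∀ s ∈ Icc a b, φ s = 0 := by
  by_contra! ⟨s, hs, hne⟩
  exact (intervalIntegral.integral_pos hab (hφ.mul hφ).continuousOn
    (fun _ _ => mul_self_nonneg _) ⟨s, hs, mul_self_pos.2 hne⟩).ne' h

/-- The linear map sending a continuous input `u` to `∫₀ᵀ exp (s L) (b (u s)) ds`. Up to the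
reversal of time it gives the states reachable from `0` at time `T`. -/
noncomputable def steeringMap [CompleteSpace E] (L : E →L[ℝ] E) (b : U →L[ℝ] E) (T : ℝ) :
    C(ℝ, U) →ₗ[ℝ] E where
  toFun u := ∫ s in (0 : ℝ)..T, NormedSpace.exp (s • L) (b (u s))
  map_add' u u' := by
    have hint (u : C(ℝ, U)) := (continuous_exp_smul_apply L
      (b.continuous.comp u.continuous)).intervalIntegrable (μ := MeasureTheory.volume) 0 T
    simpa using intervalIntegral.integral_add (hint u) (hint u')
  map_smul' a u := by simp

theorem steeringMap_apply [CompleteSpace E] (L : E →L[ℝ] E) (b : U →L[ℝ] E) (T : ℝ)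
    (u : C(ℝ, U)) :
    steeringMap L b T u = ∫ s in (0 : ℝ)..T, NormedSpace.exp (s • L) (b (u s)) :=
  rfl

theorem apply_exp_smul_eq_zero_of_apply_steeringMap [CompleteSpace E] {T : ℝ} (hT : 0 < T)
    (L : E →L[ℝ] E) (b : U →L[ℝ] E) (f : E →L[ℝ] ℝ) (h : ∀ u, f (steeringMap L b T u) = 0)
    (z : U) : ∀ s ∈ Icc 0 T, f (NormedSpace.exp (s • L) (b z)) = 0 := by
  have hexp := continuous_exp_smul_apply L (continuous_const (y := b z))
  -- The input `s ↦ φ s • z` makes `f` of the steered state equal to `∫ φ²`.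
  let φ : C(ℝ, ℝ) := ⟨fun s => f (NormedSpace.exp (s • L) (b z)), f.continuous.comp hexp⟩
  refine eq_zero_of_integral_mul_self_eq_zero φ.continuous hT ?_
  have hφ := h ⟨fun s => φ s • z, φ.continuous.smul continuous_const⟩
  rw [steeringMap_apply, ← ContinuousLinearMap.intervalIntegral_comp_comm _
    ((continuous_exp_smul_apply L (by fun_prop)).intervalIntegrable _ _)] at hφ
  simpa [φ] using hφ

theorem steeringMap_surjective [FiniteDimensional ℝ E] [CompleteSpace E] {T : ℝ} (hT : 0 < T)
    (L : E →L[ℝ] E) (b : U →L[ℝ] E)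
    (h : ∀ f : E →L[ℝ] ℝ, (∀ (n : ℕ) (z : U), f ((L ^ n) (b z)) = 0) → f = 0) :
    Function.Surjective (steeringMap L b T) := by
  rw [← LinearMap.range_eq_top]
  by_contra hne
  obtain ⟨g, hg, hker⟩ := Submodule.exists_le_ker_of_lt_top _ (lt_top_iff_ne_top.2 hne)
  let f : E →L[ℝ] ℝ := LinearMap.toContinuousLinearMap g
  have hf : f = 0 := h f fun n z => apply_pow_apply_eq_zero_of_apply_exp_smul hT L f (b z)
    (apply_exp_smul_eq_zero_of_apply_steeringMap hT L b f (fun u => hker ⟨u, rfl⟩) z) n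
  exact hg (LinearMap.ext fun x => DFunLike.congr_fun hf x)

theorem exists_steering [FiniteDimensional ℝ E] (L : E →L[ℝ] E) (b : U →L[ℝ] E)
    (h : ∀ f : E →L[ℝ] ℝ, (∀ (n : ℕ) (z : U), f ((L ^ n) (b z)) = 0) → f = 0)
    {T : ℝ} (hT : 0 < T) (x₀ x₁ : E) :
    ∃ (u : ℝ → U) (x : ℝ → E), Continuous u ∧ (∀ t, HasDerivAt x (L (x t) + b (u t)) t) ∧
      x 0 = x₀ ∧ x T = x₁ := by
  have : CompleteSpace E := FiniteDimensional.complete ℝ E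
  have hneg : ∀ f : E →L[ℝ] ℝ, (∀ (n : ℕ) (z : U), f (((-L) ^ n) (b z)) = 0) → f = 0 := by
    refine fun f hf => h f fun n z => ?_
    rcases neg_one_pow_eq_or (E →L[ℝ] E) n with hn | hn <;>
      simpa [neg_pow L, hn] using hf n z
  obtain ⟨u, hu⟩ := steeringMap_surjective hT (-L) b hneg (NormedSpace.exp (T • -L) x₁ - x₀)
  refine ⟨u, _, u.continuous, hasDerivAt_variation_of_constants L
    (b.continuous.comp u.continuous) x₀, by simp, ?_⟩
  rw [steeringMap_apply] at hu
  simp only [Function.comp_apply, hu, add_sub_cancel, exp_smul_apply_exp_smul_neg_apply]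

end SteeringOperators

section ControllabilityTests

theorem eq_zero_of_forall_apply_pow_eq_zero {K V W : Type*} [Field K] [IsAlgClosed K]
    [AddCommGroup V] [Module K V] [FiniteDimensional K V] [AddCommGroup W] [Module K W]
    (T : Module.End K V) (C : V →ₗ[K] W)
    (h : ∀ (z : V) (μ : K), T z = μ • z → C z = 0 → z = 0) {x : V}
    (hx : ∀ n : ℕ, C ((T ^ n) x) = 0) : x = 0 := by
  let N : Submodule K V := ⨅ n : ℕ, LinearMap.ker (C ∘ₗ T ^ n)
  have mem_N {z : V} : z ∈ N ↔ ∀ n : ℕ, C ((T ^ n) z) = 0 := by simp [N]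
  have hinv : ∀ z ∈ N, T z ∈ N := fun z hz =>
    mem_N.2 fun n => by simpa [pow_succ] using mem_N.1 hz (n + 1)
  by_contra hx0
  have : Nontrivial N := ⟨⟨x, mem_N.2 hx⟩, 0, by simpa using hx0⟩
  obtain ⟨μ, hμ⟩ := Module.End.exists_eigenvalue (T.restrict hinv)
  obtain ⟨z, hz⟩ := hμ.exists_hasEigenvector
  exact hz.2 (Subtype.ext (h z μ (congrArg Subtype.val hz.apply_eq_smul)
    (by simpa using mem_N.1 z.2 0)))

variable {d m : ℕ}

theorem controllable_of_kalman {A : Matrix (Fin d) (Fin d) ℝ} {B : Matrix (Fin d) (Fin m) ℝ}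
    (h : ∀ v : Fin d → ℝ, (∀ n : ℕ, v ᵥ* (A ^ n * B) = 0) → v = 0) : Controllable A B := by
  intro x₀ x₁
  let L : (Fin d → ℝ) →L[ℝ] (Fin d → ℝ) := LinearMap.toContinuousLinearMap A.mulVecLin
  let b : (Fin m → ℝ) →L[ℝ] (Fin d → ℝ) := LinearMap.toContinuousLinearMap B.mulVecLin
  have hpow (n : ℕ) (z : Fin m → ℝ) : (L ^ n) (b z) = (A ^ n * B) *ᵥ z := by
    induction n with
    | zero => simp [b]
    | succ n ih =>
      rw [pow_succ', pow_succ', Matrix.mul_assoc, ← Matrix.mulVec_mulVec, ← ih]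
      rfl
  have hkalman (f : (Fin d → ℝ) →L[ℝ] ℝ) (hf : ∀ (n : ℕ) (z : Fin m → ℝ), f ((L ^ n) (b z)) = 0) :
      f = 0 := by
    obtain ⟨v, hv⟩ := (dotProductEquiv ℝ (Fin d)).surjective (f : (Fin d → ℝ) →ₗ[ℝ] ℝ)
    have hfv (x : Fin d → ℝ) : f x = v ⬝ᵥ x := (LinearMap.congr_fun hv x).symm
    have hv0 : v = 0 := h v fun n => dotProduct_eq_zero _ fun z => by
      rw [← Matrix.dotProduct_mulVec, ← hpow, ← hfv, hf]
    ext x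
    simp [hfv, hv0]
  obtain ⟨u, x, hu, hx, hx₀, hx₁⟩ := exists_steering L b hkalman one_pos x₀ x₁
  exact ⟨1, one_pos, u, x, hu.continuousOn, fun t _ => (hx t).hasDerivWithinAt, hx₀, hx₁⟩

theorem controllable_of_hautus {A : Matrix (Fin d) (Fin d) ℝ}
    {B : Matrix (Fin d) (Fin m) ℝ}
    (h : ∀ (v : Fin d → ℂ) (μ : ℂ), v ᵥ* A.map (algebraMap ℝ ℂ) = μ • v →
      v ᵥ* B.map (algebraMap ℝ ℂ) = 0 → v = 0) : Controllable A B := by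
  refine controllable_of_kalman fun v hv => ?_
  let A' := A.map (algebraMap ℝ ℂ)
  let B' := B.map (algebraMap ℝ ℂ)
  have hpow (n : ℕ) (z : Fin d → ℂ) : (A'.vecMulLinear ^ n) z = z ᵥ* A' ^ n := by
    induction n with
    | zero => simp
    | succ n ih =>
      rw [pow_succ', Module.End.mul_apply, ih, pow_succ, ← Matrix.vecMul_vecMul]
      rfl
  have hv' : (algebraMap ℝ ℂ ∘ v) = 0 := by
    refine eq_zero_of_forall_apply_pow_eq_zero A'.vecMulLinear B'.vecMulLinear h fun n => ?_
    have hmap : A' ^ n * B' = (A ^ n * B).map (algebraMap ℝ ℂ) := by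
      rw [Matrix.map_mul, Matrix.map_pow]
    ext k
    rw [hpow, Matrix.vecMulLinear_apply, Matrix.vecMul_vecMul, hmap, ← RingHom.map_vecMul, hv]
    simp
  ext i
  simpa using congrFun hv' i

end ControllabilityTests

section IsolatedStates

theorem eq_zero_of_hasDerivWithinAt_apply {E : Type*} [NormedAddCommGroup E] [NormedSpace ℝ E]
    (L : E →L[ℝ] E) {T : ℝ} {y : ℝ → E}
    (hy : ∀ t ∈ Icc 0 T, HasDerivWithinAt y (L (y t)) (Icc 0 T) t) (hy0 : y 0 = 0) :
    ∀ t ∈ Icc 0 T, y t = 0 :=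
  eq_zero_of_abs_deriv_le_mul_abs_self_of_eq_zero_right
    (fun t ht => (hy t ht).continuousWithinAt)
    (fun t ht => (hy t (Ico_subset_Icc_self ht)).mono_of_mem_nhdsWithin (Icc_mem_nhdsGE_of_mem ht))
    hy0 (fun t _ => L.le_opNorm (y t))

theorem IsTrajectory.eq_zero_of_isolated {d m : ℕ} {A : Matrix (Fin d) (Fin d) ℝ}
    {B : Matrix (Fin d) (Fin m) ℝ} {T : ℝ} {u : ℝ → Fin m → ℝ} {x : ℝ → Fin d → ℝ}
    (hx : IsTrajectory A B T u x) {S : Finset (Fin d)}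
    (hA : ∀ i ∈ S, ∀ j ∉ S, A i j = 0) (hB : ∀ i ∈ S, ∀ k, B i k = 0) (hx0 : x 0 = 0) :
    ∀ t ∈ Icc 0 T, ∀ i ∈ S, x t i = 0 := by
  let L : (S → ℝ) →L[ℝ] (S → ℝ) :=
    LinearMap.toContinuousLinearMap (A.submatrix (↑) (↑) : Matrix S S ℝ).mulVecLin
  have hL (t : ℝ) (i : S) : L (fun j => x t j) i = (A *ᵥ x t + B *ᵥ u t) i := by
    have hBi : (B *ᵥ u t) i = 0 := by simp [Matrix.mulVec, dotProduct, hB i i.2]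
    rw [Pi.add_apply, hBi, add_zero]
    exact (Finset.sum_coe_sort S fun j => A i j * x t j).trans <|
      Finset.sum_subset S.subset_univ fun j _ hj => by rw [hA i i.2 j hj, zero_mul]
  have hzero := eq_zero_of_hasDerivWithinAt_apply L (T := T) (y := fun t (i : S) => x t i)
    (fun t ht => hasDerivWithinAt_pi.2 fun i => by
      rw [hL]
      exact hasDerivWithinAt_pi.1 (hx t ht) i)
    (by ext i; simp [hx0])
  exact fun t ht i hi => congrFun (hzero t ht) ⟨i, hi⟩

end IsolatedStates

section Digraph

variable {V : Type*} {G : Digraph V} {S T : Finset V} {a b i : V}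

/-- The set of vertices from which `a` can be reached, `a` included. -/
noncomputable def ancestors [Finite V] (G : Digraph V) (a : V) : Finset V :=
  (toFinite {b | ReflTransGen G.Adj b a}).toFinset

theorem mem_ancestors [Finite V] : b ∈ ancestors G a ↔ ReflTransGen G.Adj b a := by
  simp [ancestors]

theorem self_mem_ancestors [Finite V] : a ∈ ancestors G a :=
  mem_ancestors.2 .refl

theorem ancestors_subset [Finite V] (h : ReflTransGen G.Adj a b) :
    ancestors G a ⊆ ancestors G b :=
  fun _ hc => mem_ancestors.2 ((mem_ancestors.1 hc).trans h)

theorem IsStronglyConnectedOn.reflTransGen (h : IsStronglyConnectedOn G S) (ha : a ∈ S)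
    (hb : b ∈ S) : ReflTransGen G.Adj a b :=
  (h a ha b hb).lift id fun _ _ hpq => hpq.2.2

theorem IsSourceSCC.eq_ancestors [Finite V] (hS : IsSourceSCC G S) (ha : a ∈ S) :
    S = ancestors G a := by
  ext b
  rw [mem_ancestors]
  refine ⟨fun hb => hS.1.1.2.reflTransGen hb ha, fun hb => ?_⟩
  induction hb using ReflTransGen.head_induction_on with
  | refl => exact ha
  | head hadj _ ih => exact not_not.1 fun hb => hS.2 _ hb _ ih hadj

theorem IsSourceSCC.eq_of_mem [Finite V] (hS : IsSourceSCC G S) (hT : IsSourceSCC G T)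
    (haS : a ∈ S) (haT : a ∈ T) : S = T :=
  (hS.eq_ancestors haS).trans (hT.eq_ancestors haT).symm

theorem reflTransGen_inside_of_closed (hS : ∀ ⦃p q⦄, q ∈ S → G.Adj p q → p ∈ S)
    (h : ReflTransGen G.Adj a b) (hb : b ∈ S) :
    a ∈ S ∧ ReflTransGen (fun p q => p ∈ S ∧ q ∈ S ∧ G.Adj p q) a b := by
  induction h using ReflTransGen.head_induction_on with
  | refl => exact ⟨hb, .refl⟩
  | head hadj _ ih =>
    have ha := hS ih.1 hadj
    exact ⟨ha, ih.2.head ⟨ha, ih.1, hadj⟩⟩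

theorem isSourceSCC_ancestors [Finite V] (h : ∀ a ∈ ancestors G i, ReflTransGen G.Adj i a) :
    IsSourceSCC G (ancestors G i) := by
  have hclosed : ∀ ⦃p q⦄, q ∈ ancestors G i → G.Adj p q → p ∈ ancestors G i := fun _ _ hq hpq =>
    mem_ancestors.2 ((mem_ancestors.1 hq).head hpq)
  have hconn : IsStronglyConnectedOn G (ancestors G i) := fun a ha b hb =>
    (reflTransGen_inside_of_closed hclosed ((mem_ancestors.1 ha).trans (h b hb)) hb).2
  exact ⟨⟨⟨⟨i, self_mem_ancestors⟩, hconn⟩, fun T hT hle t ht =>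
    mem_ancestors.2 (hT.2.reflTransGen ht (hle self_mem_ancestors))⟩,
    fun a ha b hb hab => ha (hclosed hb hab)⟩

theorem exists_isSourceSCC_reflTransGen [Finite V] (G : Digraph V) (i : V) :
    ∃ S, IsSourceSCC G S ∧ ∀ a ∈ S, ReflTransGen G.Adj a i := by
  -- An ancestor of `i` with the fewest ancestors lies in a source component.
  obtain ⟨j, hj, hmin⟩ := Finset.exists_min_image (ancestors G i)
    (fun j => (ancestors G j).card) ⟨i, self_mem_ancestors⟩
  rw [mem_ancestors] at hj
  refine ⟨ancestors G j, isSourceSCC_ancestors fun a ha => ?_,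
    fun a ha => (mem_ancestors.1 ha).trans hj⟩
  rw [mem_ancestors] at ha
  have heq : ancestors G a = ancestors G j := Finset.eq_of_subset_of_card_le (ancestors_subset ha)
    (hmin a (mem_ancestors.2 (ha.trans hj)))
  exact mem_ancestors.1 (heq ▸ self_mem_ancestors)

end Digraph

section Cycles

open Equiv.Perm

variable {V R : Type*}

/-- The cycles of a permutation, fixed points included. -/
abbrev Cycles (σ : Equiv.Perm V) : Type _ :=
  Quotient (SameCycle.setoid σ)

theorem Cycles.mk_eq_mk {σ : Equiv.Perm V} {i j : V} :
    (⟦i⟧ : Cycles σ) = ⟦j⟧ ↔ σ.SameCycle i j :=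
  Quotient.eq

/-- The cycles on which the vector `v` does not vanish identically. -/
def cycleSupport [Zero R] (σ : Equiv.Perm V) (v : V → R) : Set (Cycles σ) :=
  {q | ∃ j, ⟦j⟧ = q ∧ v j ≠ 0}

theorem eq_zero_of_mk_notMem_cycleSupport [Zero R] {σ : Equiv.Perm V} {v : V → R} {j : V}
    (h : (⟦j⟧ : Cycles σ) ∉ cycleSupport σ v) : v j = 0 :=
  not_not.1 fun hj => h ⟨j, rfl, hj⟩

theorem forall_sameCycle_of_step [Finite V] {σ : Equiv.Perm V} {p : V} {P : V → Prop}
    (h0 : P (σ p)) (hstep : ∀ j, σ.SameCycle p j → j ≠ p → P j → P (σ j)) :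
    ∀ j, σ.SameCycle p j → P j := by
  have hpow (n : ℕ) : P ((σ ^ (n + 1)) p) := by
    induction n with
    | zero => simpa using h0
    | succ n ih =>
      rw [pow_succ', mul_apply]
      by_cases hp : (σ ^ (n + 1)) p = p
      · rwa [hp]
      · exact hstep _ (sameCycle_pow_right.2 (.refl σ p)) hp ih
  intro j hj
  obtain ⟨n, hn, -, rfl⟩ := hj.exists_pow_eq''
  obtain ⟨k, rfl⟩ := Nat.exists_eq_add_one.2 hn
  exact hpow k

variable [CommRing R] [IsDomain R] {σ : Equiv.Perm V} {v : V → R} {c μ : R}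

theorem pow_orderOf_eq_of_forall_sameCycle {i : V} (hv : v i ≠ 0)
    (h : ∀ j, σ.SameCycle i j → c * v (σ j) = μ * v j) : c ^ orderOf σ = μ ^ orderOf σ := by
  have hpow (n : ℕ) : c ^ n * v ((σ ^ n) i) = μ ^ n * v i := by
    induction n with
    | zero => simp
    | succ n ih =>
      rw [pow_succ' σ, mul_apply, pow_succ, mul_assoc, h _ (sameCycle_pow_right.2 (.refl σ i)),
        mul_left_comm, ih, pow_succ', mul_assoc]
  refine mul_right_cancel₀ hv ?_
  simpa [pow_orderOf_eq_one] using hpow (orderOf σ)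

theorem eq_zero_of_forall_sameCycle_ne [Finite V] (hc : c ≠ 0) (hμ : μ ≠ 0) {p i : V}
    (hi : σ.SameCycle p i) (hvi : v i = 0)
    (h : ∀ j, σ.SameCycle p j → j ≠ p → c * v (σ j) = μ * v j) :
    ∀ j, σ.SameCycle p j → v j = 0 := by
  have hiff : ∀ j, σ.SameCycle p j → (v j = 0 ↔ v (σ p) = 0) := by
    refine forall_sameCycle_of_step Iff.rfl fun j hj hjp ih => ?_
    rw [← ih, ← mul_eq_zero_iff_left hc, h j hj hjp, mul_eq_zero_iff_left hμ]
  exact fun j hj => (hiff j hj).2 ((hiff i hi).1 hvi)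

end Cycles

section CycleForest

open Equiv.Perm

variable {V I K : Type*}

/-- A spanning forest on the cycles of `σ`: each cycle `q` hangs by an edge from `source q` to its
state `entry q`, where the source is either a state of another cycle, the parent of `q`, or an
input. The roots are the cycles hanging from inputs; `E s i` means that `s` may act on `i`. -/
structure CycleForest (σ : Equiv.Perm V) (E : V ⊕ I → V → Prop) where
  source : Cycles σ → V ⊕ I
  entry : Cycles σ → V
  depth : Cycles σ → ℕ
  mk_entry : ∀ q, (⟦entry q⟧ : Cycles σ) = q
  edge : ∀ q, E (source q) (entry q)
  depth_eq : ∀ q, depth q = Sum.elim (fun p => depth (⟦p⟧) + 1) (fun _ => 0) (source q)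

namespace CycleForest

variable {σ : Equiv.Perm V} {E : V ⊕ I → V → Prop} (F : CycleForest σ E)

/-- The cycle `r` hangs from a state of the cycle `q`. -/
def IsChild (r q : Cycles σ) : Prop :=
  ∃ p, F.source r = .inl p ∧ ⟦p⟧ = q

variable {F}

theorem depth_eq_of_source_eq {q r : Cycles σ} (h : F.source q = F.source r) :
    F.depth q = F.depth r := by
  rw [F.depth_eq, F.depth_eq r, h]

theorem IsChild.depth_eq {q r : Cycles σ} (h : F.IsChild r q) : F.depth r = F.depth q + 1 := by
  obtain ⟨p, hp, rfl⟩ := h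
  rw [F.depth_eq, hp, Sum.elim_inl]

theorem isChild_rightUnique : Relator.RightUnique F.IsChild := by
  rintro r _ _ ⟨p, hp, rfl⟩ ⟨p', hp', rfl⟩
  rw [Sum.inl.inj (hp.symm.trans hp')]

theorem eq_or_depth_lt_of_descendant {q r : Cycles σ} (h : ReflTransGen F.IsChild r q) :
    r = q ∨ F.depth q < F.depth r := by
  induction h with
  | refl => exact .inl rfl
  | tail _ hchild ih =>
    have := hchild.depth_eq
    rcases ih with rfl | ih <;> omega

theorem eq_of_common_descendant {q q' r : Cycles σ} (hq : ReflTransGen F.IsChild r q)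
    (hq' : ReflTransGen F.IsChild r q') (hdepth : F.depth q = F.depth q') : q = q' := by
  rcases ReflTransGen.total_of_right_unique isChild_rightUnique hq hq' with h | h
  · exact (eq_or_depth_lt_of_descendant h).resolve_right hdepth.not_gt
  · exact ((eq_or_depth_lt_of_descendant h).resolve_right hdepth.not_lt).symm

variable [DecidableEq V] [DecidableEq I]

variable (F) in
/-- The edges by which the cycles hang, with weight `1`. The columns are indexed by the possible
sources: the states and the inputs. -/
def treeMatrix (K : Type*) [Zero K] [One K] : Matrix V (V ⊕ I) K :=
  .of fun i s => if F.entry ⟦i⟧ = i ∧ F.source ⟦i⟧ = s then 1 else 0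

variable (F) in
/-- The edges of each cycle `q` with weight `c q`, together with the edges by which cycles hang
from states. -/
def stateMatrix [NonAssocSemiring K] (c : Cycles σ → K) : Matrix V V K :=
  .of fun i j => (if i = σ j then c ⟦j⟧ else 0) + F.treeMatrix K i (.inl j)

variable (F) in
/-- The edges by which cycles hang from inputs. -/
def inputMatrix (K : Type*) [Zero K] [One K] : Matrix V I K :=
  (F.treeMatrix K).submatrix id .inr

theorem treeMatrix_apply_eq_zero [Zero K] [One K] {i : V} {s : V ⊕ I} (h : ¬E s i) :
    F.treeMatrix K i s = 0 := by
  refine if_neg fun ⟨hi, hs⟩ => h ?_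
  simpa only [hi, hs] using F.edge ⟦i⟧

theorem stateMatrix_apply_eq_zero [NonAssocSemiring K] {c : Cycles σ → K}
    (hσ : ∀ j, E (.inl j) (σ j)) {i j : V} (h : ¬E (.inl j) i) : F.stateMatrix c i j = 0 := by
  have hij : i ≠ σ j := fun hij => h (hij ▸ hσ j)
  simp [stateMatrix, treeMatrix_apply_eq_zero h, hij]

section Map

variable {L : Type*} [NonAssocSemiring K] [NonAssocSemiring L] (f : K →+* L)

theorem map_treeMatrix : (F.treeMatrix K).map f = F.treeMatrix L := by
  ext i s
  simp [treeMatrix, apply_ite f]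

theorem map_inputMatrix : (F.inputMatrix K).map f = F.inputMatrix L := by
  rw [inputMatrix, ← Matrix.submatrix_map, map_treeMatrix, inputMatrix]

theorem map_stateMatrix (c : Cycles σ → K) :
    (F.stateMatrix c).map f = F.stateMatrix (f ∘ c) := by
  ext i j
  simp [stateMatrix, ← map_treeMatrix f, apply_ite f]

end Map

section VecMul

variable [Fintype V]

theorem vecMul_treeMatrix_eq_zero [NonAssocSemiring K] {v : V → K} {s : V ⊕ I}
    (h : ∀ q, F.source q = s → v (F.entry q) = 0) : (v ᵥ* F.treeMatrix K) s = 0 := by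
  refine Finset.sum_eq_zero fun i _ => ?_
  by_cases hi : F.entry ⟦i⟧ = i ∧ F.source ⟦i⟧ = s
  · rw [← hi.1, h _ hi.2, zero_mul]
  · simp [treeMatrix, hi]

theorem vecMul_treeMatrix_source [NonAssocSemiring K] {v : V → K} {q : Cycles σ}
    (h : ∀ r ≠ q, F.source r = F.source q → v (F.entry r) = 0) :
    (v ᵥ* F.treeMatrix K) (F.source q) = v (F.entry q) := by
  refine (Fintype.sum_eq_single (F.entry q) fun i hi => ?_).trans ?_
  · by_cases hs : F.entry ⟦i⟧ = i ∧ F.source ⟦i⟧ = F.source q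
    · have hne : (⟦i⟧ : Cycles σ) ≠ q := fun hiq => hi (hiq ▸ hs.1).symm
      rw [← hs.1, h _ hne hs.2, zero_mul]
    · simp [treeMatrix, hs]
  · simp [treeMatrix, F.mk_entry]

theorem vecMul_stateMatrix_apply [CommSemiring K] (v : V → K) (c : Cycles σ → K) (j : V) :
    (v ᵥ* F.stateMatrix c) j = c ⟦j⟧ * v (σ j) + (v ᵥ* F.treeMatrix K) (.inl j) := by
  simp [Matrix.vecMul, dotProduct, stateMatrix, mul_add, Finset.sum_add_distrib, mul_comm]

end VecMul

variable [Fintype V] [CommRing K] {v : V → K} {c : Cycles σ → K} {μ : K}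

theorem mul_apply_of_vecMul_stateMatrix (hμ : v ᵥ* F.stateMatrix c = μ • v) {j : V}
    (hj : ∀ r ∈ cycleSupport σ v, F.source r ≠ .inl j) : c ⟦j⟧ * v (σ j) = μ * v j := by
  have htree : (v ᵥ* F.treeMatrix K) (.inl j) = 0 := vecMul_treeMatrix_eq_zero fun r hr =>
    eq_zero_of_mk_notMem_cycleSupport fun hmem => hj r (F.mk_entry r ▸ hmem) hr
  have hvj := congrFun hμ j
  rwa [vecMul_stateMatrix_apply, htree, add_zero] at hvj

variable [IsDomain K]

theorem exists_resonant_descendant (hμ : v ᵥ* F.stateMatrix c = μ • v) {q : Cycles σ}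
    (hq : q ∈ cycleSupport σ v) :
    ∃ r, ReflTransGen F.IsChild r q ∧ c r ^ orderOf σ = μ ^ orderOf σ := by
  by_contra! hcon
  obtain ⟨_, ⟨⟨i, rfl, hi⟩, hdead⟩, hmax⟩ := exists_max_image
    {q ∈ cycleSupport σ v | ∀ r, ReflTransGen F.IsChild r q → c r ^ orderOf σ ≠ μ ^ orderOf σ}
    F.depth (toFinite _) ⟨q, hq, hcon⟩
  refine hdead ⟦i⟧ .refl (pow_orderOf_eq_of_forall_sameCycle hi fun j hj => ?_)
  have hij : (⟦i⟧ : Cycles σ) = ⟦j⟧ := Cycles.mk_eq_mk.2 hj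
  rw [hij]
  refine mul_apply_of_vecMul_stateMatrix hμ fun r hr hrj => ?_
  have hchild : F.IsChild r ⟦i⟧ := ⟨j, hrj, hij.symm⟩
  have hle := hmax r ⟨hr, fun r' hr' => hdead r' (hr'.tail hchild)⟩
  rw [hchild.depth_eq] at hle
  omega

theorem eq_of_mem_cycleSupport (hinj : Function.Injective fun q => c q ^ orderOf σ)
    (hμ : v ᵥ* F.stateMatrix c = μ • v) {q q' : Cycles σ} (hq : q ∈ cycleSupport σ v)
    (hq' : q' ∈ cycleSupport σ v) (hdepth : F.depth q = F.depth q') : q = q' := by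
  obtain ⟨r, hrq, hr⟩ := exists_resonant_descendant hμ hq
  obtain ⟨r', hrq', hr'⟩ := exists_resonant_descendant hμ hq'
  obtain rfl : r = r' := hinj (hr.trans hr'.symm)
  exact eq_of_common_descendant hrq hrq' hdepth

theorem apply_entry_eq_zero (hinj : Function.Injective fun q => c q ^ orderOf σ)
    (hμ : v ᵥ* F.stateMatrix c = μ • v) (hv : v ᵥ* F.inputMatrix K = 0) {q : Cycles σ}
    (hq : q ∈ cycleSupport σ v) (hmin : ∀ r ∈ cycleSupport σ v, F.depth q ≤ F.depth r) :
    v (F.entry q) = 0 := by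
  have hsource : (v ᵥ* F.treeMatrix K) (F.source q) = v (F.entry q) :=
    vecMul_treeMatrix_source fun r hne hr => eq_zero_of_mk_notMem_cycleSupport fun hmem =>
      hne (eq_of_mem_cycleSupport hinj hμ (F.mk_entry r ▸ hmem) hq (depth_eq_of_source_eq hr))
  rw [← hsource]
  cases hs : F.source q with
  | inr k => exact congrFun hv k
  | inl p =>
    have hchild : F.IsChild q ⟦p⟧ := ⟨p, hs, rfl⟩
    have hp : ∀ j, (⟦j⟧ : Cycles σ) = ⟦p⟧ → v j = 0 := fun j hj =>
      eq_zero_of_mk_notMem_cycleSupport fun hmem => by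
        have := hmin _ (hj ▸ hmem)
        have := hchild.depth_eq
        omega
    have hσp : (⟦σ p⟧ : Cycles σ) = ⟦p⟧ := Cycles.mk_eq_mk.2 (sameCycle_apply_left.2 (.refl σ p))
    simpa [vecMul_stateMatrix_apply, hp p rfl, hp _ hσp] using congrFun hμ p

theorem exists_forall_ne_mul_apply (hinj : Function.Injective fun q => c q ^ orderOf σ)
    (hμ : v ᵥ* F.stateMatrix c = μ • v) (q : Cycles σ) :
    ∃ p, ⟦p⟧ = q ∧ ∀ j, σ.SameCycle p j → j ≠ p → c q * v (σ j) = μ * v j := by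
  by_cases hchild : ∃ r ∈ cycleSupport σ v, F.IsChild r q
  · obtain ⟨r, hr, p, hrp, rfl⟩ := hchild
    refine ⟨p, rfl, fun j hj hjp => ?_⟩
    have hpj : (⟦p⟧ : Cycles σ) = ⟦j⟧ := Cycles.mk_eq_mk.2 hj
    rw [hpj]
    refine mul_apply_of_vecMul_stateMatrix hμ fun r' hr' hr'j => hjp ?_
    obtain rfl : r = r' := eq_of_mem_cycleSupport hinj hμ hr hr' <| by
      rw [F.depth_eq, F.depth_eq r', hrp, hr'j, Sum.elim_inl, Sum.elim_inl, hpj]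
    exact Sum.inl.inj (hr'j.symm.trans hrp)
  · refine ⟨F.entry q, F.mk_entry q, fun j hj _ => ?_⟩
    have hjq : (⟦j⟧ : Cycles σ) = q := (Cycles.mk_eq_mk.2 hj.symm).trans (F.mk_entry q)
    rw [← hjq]
    exact mul_apply_of_vecMul_stateMatrix hμ fun r hr hrj => hchild ⟨r, hr, j, hrj, hjq⟩

theorem eq_zero_of_vecMul (hc : ∀ q, c q ≠ 0)
    (hinj : Function.Injective fun q => c q ^ orderOf σ) (hμ : v ᵥ* F.stateMatrix c = μ • v)
    (hv : v ᵥ* F.inputMatrix K = 0) : v = 0 := by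
  by_contra hne
  obtain ⟨i, hi⟩ := Function.ne_iff.1 hne
  obtain ⟨q, hq, hmin⟩ := exists_min_image (cycleSupport σ v) F.depth (toFinite _) ⟨⟦i⟧, i, rfl, hi⟩
  obtain ⟨r, -, hr⟩ := exists_resonant_descendant hμ hq
  have hμ0 : μ ≠ 0 := (pow_ne_zero_iff (orderOf_pos σ).ne').1 (hr ▸ pow_ne_zero _ (hc r))
  have hentry := apply_entry_eq_zero hinj hμ hv hq hmin
  obtain ⟨p, hp, hrel⟩ := exists_forall_ne_mul_apply hinj hμ q
  obtain ⟨j, hjq, hj⟩ := hq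
  exact hj (eq_zero_of_forall_sameCycle_ne (hc _) hμ0
    (Cycles.mk_eq_mk.1 (hp.trans (F.mk_entry _).symm)) hentry hrel j
    (Cycles.mk_eq_mk.1 (hp.trans hjq.symm)))

end CycleForest

/-- `CycleReach σ E n q`: a chain of `n + 1` cycles of `σ`, each acting on the next one along an
edge of `E` and the first one driven by an input, ends at the cycle `q`. -/
inductive CycleReach (σ : Equiv.Perm V) (E : V ⊕ I → V → Prop) : ℕ → Cycles σ → Prop
  | input {k : I} {i : V} (h : E (.inr k) i) : CycleReach σ E 0 ⟦i⟧
  | state {n : ℕ} {j i : V} (h : E (.inl j) i) (hj : CycleReach σ E n ⟦j⟧) :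
      CycleReach σ E (n + 1) ⟦i⟧

theorem nonempty_cycleForest {σ : Equiv.Perm V} {E : V ⊕ I → V → Prop}
    (h : ∀ q, ∃ n, CycleReach σ E n q) : Nonempty (CycleForest σ E) := by
  let depth (q : Cycles σ) : ℕ := sInf {n | CycleReach σ E n q}
  have hdepth (q) : CycleReach σ E (depth q) q := Nat.sInf_mem (h q)
  have hexists (q) : ∃ s i, ⟦i⟧ = q ∧ E s i ∧
      depth q = Sum.elim (fun p => depth (⟦p⟧) + 1) (fun _ => 0) s := by
    generalize hn : depth q = n
    cases hn ▸ hdepth q with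
    | @input k i hE => exact ⟨.inr k, i, rfl, hE, rfl⟩
    | @state n j i hE hj =>
      have hle : depth ⟦j⟧ ≤ n := Nat.sInf_le hj
      have hge : depth ⟦i⟧ ≤ depth ⟦j⟧ + 1 := Nat.sInf_le (.state hE (hdepth _))
      exact ⟨.inl j, i, rfl, hE, by simp only [Sum.elim_inl]; omega⟩
  choose source entry hmk hedge hdepth_eq using hexists
  exact ⟨⟨source, entry, depth, hmk, hedge, hdepth_eq⟩⟩

end CycleForest

section StructuralControllability

variable {d m : ℕ} {A : Sparsity d d} {N : Sparsity d m}

theorem StructurallyControllable.exists_input (h : StructurallyControllable A N)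
    {S : Finset (Fin d)} (hS : IsSourceSCC (stateDigraph A) S) : ∃ i ∈ S, ∃ k, N i k = true := by
  by_contra! hcon
  obtain ⟨RA, RB, hRA, hRB, hc⟩ := h
  obtain ⟨i, hi⟩ := hS.1.1.1
  obtain ⟨T, hT, u, x, -, hx, hx0, hx1⟩ := hc 0 1
  have hzero : x T i = 0 := hx.eq_zero_of_isolated
    (fun i hi j hj => hRA i j (by simpa [stateDigraph] using hS.2 j hj i hi))
    (fun i hi k => hRB i k (by simpa using hcon i hi k)) hx0 T ⟨hT.le, le_rfl⟩ i hi
  simp [hx1] at hzero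

theorem HasPerfectMatching.exists_perm (h : HasPerfectMatching A) :
    ∃ σ : Equiv.Perm (Fin d), ∀ j, A (σ j) j = true := by
  obtain ⟨M, hM⟩ := h
  rw [SimpleGraph.Subgraph.isPerfectMatching_iff] at hM
  have hpartner (j : Fin d) : ∃ i, A i j = true ∧ M.Adj (.inl j) (.inr i) := by
    obtain ⟨w, hw, -⟩ := hM (.inl j)
    have hadj := hw.adj_sub
    simp only [bipartiteGraph, SimpleGraph.fromRel_adj] at hadj
    rcases hadj.2 with ⟨i, j', hA, hj, rfl⟩ | ⟨i, j', -, -, hj⟩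
    · cases hj
      exact ⟨i, hA, hw⟩
    · cases hj
  choose f hfA hfM using hpartner
  have hinj : Function.Injective f := fun j j' hjj' =>
    Sum.inl.inj ((hM (.inr (f j))).unique (hfM j).symm (hjj' ▸ (hfM j').symm))
  exact ⟨.ofBijective f (Finite.injective_iff_bijective.1 hinj), hfA⟩

/-- The edges of the system graph: from the state `j` or the input `k`, encoded as `inl j` and
`inr k`, to the states on which it may act. -/
def systemEdge (A : Sparsity d d) (N : Sparsity d m) (s : Fin d ⊕ Fin m) (i : Fin d) : Prop :=
  Sum.elim (A i) (N i) s = true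

theorem exists_cycleReach_of_input (σ : Equiv.Perm (Fin d))
    (hN : ∀ S, IsSourceSCC (stateDigraph A) S → ∃ i ∈ S, ∃ k, N i k = true) (q : Cycles σ) :
    ∃ n, CycleReach σ (systemEdge A N) n q := by
  obtain ⟨i, rfl⟩ := Quotient.exists_rep q
  obtain ⟨S, hS, hSi⟩ := exists_isSourceSCC_reflTransGen (stateDigraph A) i
  obtain ⟨a, ha, k, hk⟩ := hN S hS
  have hai := hSi a ha
  clear hSi
  induction hai with
  | refl => exact ⟨0, .input (E := systemEdge A N) hk⟩
  | tail _ hadj ih =>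
    obtain ⟨n, hn⟩ := ih
    exact ⟨n + 1, .state (E := systemEdge A N) hadj hn⟩

theorem structurallyControllable_of_cycleForest {σ : Equiv.Perm (Fin d)}
    (hσ : ∀ j, A (σ j) j = true) (F : CycleForest σ (systemEdge A N)) :
    StructurallyControllable A N := by
  let c (q : Cycles σ) : ℝ := (Finite.equivFin (Cycles σ) q : ℕ) + 1
  have hpos (q) : 0 < c q := by positivity
  have hcinj : Function.Injective c := fun q r h => by simpa [c, Fin.val_inj] using h
  have hpowinj : Function.Injective fun q => (c q : ℂ) ^ orderOf σ := fun q r h => hcinj <|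
    (pow_left_inj₀ (hpos q).le (hpos r).le (orderOf_pos σ).ne').1 <|
      Complex.ofReal_injective (by simpa using h)
  refine ⟨F.stateMatrix c, F.inputMatrix ℝ, fun i j hij => ?_, fun i k hik => ?_,
    controllable_of_hautus fun v μ hv hv0 => ?_⟩
  · exact CycleForest.stateMatrix_apply_eq_zero hσ (by simp [systemEdge, hij])
  · exact CycleForest.treeMatrix_apply_eq_zero (by simp [systemEdge, hik])
  · rw [CycleForest.map_stateMatrix] at hv
    rw [CycleForest.map_inputMatrix] at hv0
    exact CycleForest.eq_zero_of_vecMul (fun q => Complex.ofReal_ne_zero.2 (hpos q).ne') hpowinj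
      hv hv0

theorem structurallyControllable_of_input (hA : HasPerfectMatching A)
    (hN : ∀ S, IsSourceSCC (stateDigraph A) S → ∃ i ∈ S, ∃ k, N i k = true) :
    StructurallyControllable A N := by
  obtain ⟨σ, hσ⟩ := hA.exists_perm
  obtain ⟨F⟩ := nonempty_cycleForest (exists_cycleReach_of_input σ hN)
  exact structurallyControllable_of_cycleForest hσ F

end StructuralControllability

section Transversals

variable {d m : ℕ} {A : Sparsity d d} {B N : Sparsity d m} {w : Matrix (Fin d) (Fin m) ℝ}

/-- The positions of the `⋆` entries of a sparsity matrix. -/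
def support (N : Sparsity d m) : Finset (Fin d × Fin m) :=
  {p | N p.1 p.2 = true}

theorem mem_support {p : Fin d × Fin m} : p ∈ support N ↔ N p.1 p.2 = true := by
  simp [support]

theorem nnzCount_eq_card_support (N : Sparsity d m) : nnzCount N = (support N).card := by
  rw [support, Finset.card_filter, Fintype.sum_prod_type, nnzCount]

theorem totalCost_eq_sum_support (w : Matrix (Fin d) (Fin m) ℝ) (N : Sparsity d m) :
    totalCost w N = ∑ p ∈ support N, w p.1 p.2 := by
  rw [support, Finset.sum_filter, Fintype.sum_prod_type, totalCost]

/-- The source strongly connected components of `G(A)`, as a type. -/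
abbrev SourceComponent (A : Sparsity d d) : Type :=
  {S : Finset (Fin d) // IsSourceSCC (stateDigraph A) S}

noncomputable instance : Fintype (SourceComponent A) :=
  Fintype.ofFinite _

/-- `f` picks for each source component a `⋆` entry of `N` in one of its rows. -/
def IsTransversal (A : Sparsity d d) (N : Sparsity d m)
    (f : SourceComponent A → Fin d × Fin m) : Prop :=
  ∀ S, (f S).1 ∈ S.1 ∧ f S ∈ support N

theorem StructurallyControllable.exists_isTransversal (h : StructurallyControllable A N) :
    ∃ f, IsTransversal A N f := by
  choose i hi k hk using fun S : SourceComponent A => h.exists_input S.2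
  exact ⟨fun S => (i S, k S), fun S => ⟨hi S, mem_support.2 (hk S)⟩⟩

namespace IsTransversal

variable {f : SourceComponent A → Fin d × Fin m}

theorem structurallyControllable (hf : IsTransversal A N f) (hA : HasPerfectMatching A) :
    StructurallyControllable A N :=
  structurallyControllable_of_input hA fun S hS =>
    ⟨_, (hf ⟨S, hS⟩).1, _, mem_support.1 (hf ⟨S, hS⟩).2⟩

theorem injective (hf : IsTransversal A N f) : Function.Injective f := fun S T hST =>
  Subtype.ext (S.2.eq_of_mem T.2 (hf S).1 (hST ▸ (hf T).1))

theorem image_subset (hf : IsTransversal A N f) : Finset.univ.image f ⊆ support N :=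
  Finset.image_subset_iff.2 fun S _ => (hf S).2

theorem card_image (hf : IsTransversal A N f) :
    (Finset.univ.image f).card = Fintype.card (SourceComponent A) :=
  Finset.card_image_of_injective _ hf.injective

theorem card_le_nnzCount (hf : IsTransversal A N f) :
    Fintype.card (SourceComponent A) ≤ nnzCount N := by
  rw [← hf.card_image, nnzCount_eq_card_support]
  exact Finset.card_le_card hf.image_subset

theorem image_eq_support (hf : IsTransversal A N f)
    (hcard : nnzCount N ≤ Fintype.card (SourceComponent A)) : Finset.univ.image f = support N :=
  Finset.eq_of_subset_of_card_le hf.image_subset <| by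
    rwa [hf.card_image, ← nnzCount_eq_card_support]

theorem totalCost_eq (hf : IsTransversal A N f)
    (hcard : nnzCount N ≤ Fintype.card (SourceComponent A)) (w : Matrix (Fin d) (Fin m) ℝ) :
    totalCost w N = ∑ S, w (f S).1 (f S).2 := by
  rw [totalCost_eq_sum_support, ← hf.image_eq_support hcard,
    Finset.sum_image hf.injective.injOn]

theorem solvesP2 (hf : IsTransversal A N f) (hN : N ∈ admissible A B)
    (hcard : nnzCount N ≤ Fintype.card (SourceComponent A))
    (hmin : ∀ S : SourceComponent A, ∀ i ∈ S.1, ∀ k, B i k = true → w (f S).1 (f S).2 ≤ w i k) :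
    SolvesP2 A B w N := by
  refine ⟨⟨hN, fun N₂ hN₂ => ?_⟩, fun N₂ hN₂ => ?_⟩
  · obtain ⟨f₂, hf₂⟩ := hN₂.2.exists_isTransversal
    exact hcard.trans hf₂.card_le_nnzCount
  · obtain ⟨f₂, hf₂⟩ := hN₂.1.2.exists_isTransversal
    rw [hf.totalCost_eq hcard, hf₂.totalCost_eq ((hN₂.2 N hN).trans hcard)]
    refine Finset.sum_le_sum fun S _ => hmin S _ (hf₂ S).1 _ ?_
    have hN₂S := mem_support.1 (hf₂ S).2
    by_contra hB
    rw [hN₂.1.1 _ _ (by simpa using hB)] at hN₂S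
    cases hN₂S

end IsTransversal

end Transversals

section GreedyAlgorithm

variable {d m : ℕ} {A : Sparsity d d} {B N : Sparsity d m} {w : Matrix (Fin d) (Fin m) ℝ}
  {S : Finset (Fin d)} {k : Fin m} {l : Fin d}

theorem exists_selects [Nonempty (Fin m)] (B : Sparsity d m) (w : Matrix (Fin d) (Fin m) ℝ)
    (hS : S.Nonempty) : ∃ k l, Selects B w S k l := by
  choose best hbest using fun i => Finite.exists_min (extCost B w i)
  obtain ⟨l, hl, hmin⟩ := Finset.exists_min_image S (fun i => extCost B w i (best i)) hS
  exact ⟨best l, l, best, fun i _ => hbest i, hl, hmin, rfl⟩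

theorem Selects.mem (h : Selects B w S k l) : l ∈ S := by
  obtain ⟨_, _, hl, _⟩ := h
  exact hl

theorem Selects.extCost_le (h : Selects B w S k l) :
    ∀ i ∈ S, ∀ k₂, extCost B w l k ≤ extCost B w i k₂ := by
  obtain ⟨best, hbest, -, hmin, rfl⟩ := h
  exact fun i hi k₂ => (hmin i hi).trans (hbest i hi k₂)

theorem Selects.eq_true (h : Selects B w S k l) (hS : ∃ i ∈ S, ∃ k, B i k = true) :
    B l k = true := by
  obtain ⟨i, hi, k₂, hk₂⟩ := hS
  by_contra hB
  simpa [extCost, hB, hk₂] using h.extCost_le i hi k₂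

theorem Selects.cost_le (h : Selects B w S k l) : ∀ i ∈ S, ∀ k₂, B i k₂ = true → w l k ≤ w i k₂ :=
  fun i hi k₂ hk₂ => by
    simpa [extCost, h.eq_true ⟨i, hi, k₂, hk₂⟩, hk₂] using h.extCost_le i hi k₂

section LoopRun

variable {comps : List (Finset (Fin d))} {L L₂ : Finset (Fin m × Fin d)}

theorem exists_loopRun (comps : List (Finset (Fin d))) (h : ∀ S ∈ comps, ∃ k l, Selects B w S k l)
    (L : Finset (Fin m × Fin d)) : ∃ L₂, LoopRun B w comps L L₂ := by
  induction comps generalizing L with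
  | nil => exact ⟨L, .done L⟩
  | cons S comps ih =>
    obtain ⟨k, l, hsel⟩ := h S List.mem_cons_self
    obtain ⟨L₂, hL₂⟩ := ih (fun T hT => h T (List.mem_cons_of_mem _ hT)) (insert (k, l) L)
    exact ⟨L₂, .step S comps k l L L₂ hsel hL₂⟩

theorem LoopRun.subset (h : LoopRun B w comps L L₂) : L ⊆ L₂ := by
  induction h with
  | done => exact subset_rfl
  | step _ _ _ _ _ _ _ _ ih => exact (Finset.subset_insert _ _).trans ih

theorem LoopRun.card_le (h : LoopRun B w comps L L₂) : L₂.card ≤ L.card + comps.length := by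
  induction h with
  | done => simp
  | step S comps k l L L₂ _ _ ih =>
    have := Finset.card_insert_le (k, l) L
    rw [List.length_cons]
    omega

theorem LoopRun.exists_selects (h : LoopRun B w comps L L₂) :
    ∀ S ∈ comps, ∃ k l, (k, l) ∈ L₂ ∧ Selects B w S k l := by
  induction h with
  | done => simp
  | step S comps k l L L₂ hsel hrun ih =>
    exact List.forall_mem_cons.2 ⟨⟨k, l, hrun.subset (Finset.mem_insert_self _ _), hsel⟩, ih⟩

end LoopRun

theorem exists_isAlgorithmOutput (w : Matrix (Fin d) (Fin m) ℝ)
    (hAB : StructurallyControllable A B) : ∃ N, IsAlgorithmOutput A B w N := by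
  let comps := (toFinite {S | IsSourceSCC (stateDigraph A) S}).toFinset.toList
  have hcomps (S) : S ∈ comps ↔ IsSourceSCC (stateDigraph A) S := by simp [comps]
  have hsel : ∀ S ∈ comps, ∃ k l, Selects B w S k l := fun S hS => by
    have hS := (hcomps S).1 hS
    obtain ⟨_, _, k, _⟩ := hAB.exists_input hS
    have : Nonempty (Fin m) := ⟨k⟩
    exact exists_selects B w hS.1.1.1
  obtain ⟨L, hL⟩ := exists_loopRun comps hsel ∅
  exact ⟨fun l k => decide ((k, l) ∈ L), comps, L, Finset.nodup_toList _, hcomps, hL, by simp⟩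

namespace IsAlgorithmOutput

theorem nnzCount_le (h : IsAlgorithmOutput A B w N) :
    nnzCount N ≤ Fintype.card (SourceComponent A) := by
  obtain ⟨comps, L, hnodup, hcomps, hrun, hN⟩ := h
  have hsupport : (support N).map (Equiv.prodComm _ _).toEmbedding = L := by
    ext ⟨k, l⟩
    simp [mem_support, hN]
  calc nnzCount N = L.card := by rw [nnzCount_eq_card_support, ← hsupport, Finset.card_map]
    _ ≤ comps.length := by simpa using hrun.card_le
    _ = comps.toFinset.card := (List.toFinset_card_of_nodup hnodup).symm
    _ = Fintype.card (SourceComponent A) :=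
      (Fintype.card_of_subtype _ fun S => by rw [List.mem_toFinset, hcomps]).symm

theorem exists_isTransversal (h : IsAlgorithmOutput A B w N) :
    ∃ f, IsTransversal A N f ∧ ∀ S : SourceComponent A, Selects B w S.1 (f S).2 (f S).1 := by
  obtain ⟨comps, L, -, hcomps, hrun, hN⟩ := h
  choose k l hL hsel using fun S : SourceComponent A =>
    hrun.exists_selects S.1 ((hcomps S.1).2 S.2)
  exact ⟨fun S => (l S, k S), fun S => ⟨(hsel S).mem, mem_support.2 ((hN _ _).2 (hL S))⟩, hsel⟩

theorem solvesP2 (h : IsAlgorithmOutput A B w N) (hAB : StructurallyControllable A B)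
    (hA : HasPerfectMatching A) : SolvesP2 A B w N := by
  obtain ⟨f, hf, hsel⟩ := h.exists_isTransversal
  have hNB : ∀ i k, B i k = false → N i k = false := fun i k hB => by
    by_contra hN
    have hik : (i, k) ∈ support N := mem_support.2 (by simpa using hN)
    rw [← hf.image_eq_support h.nnzCount_le, Finset.mem_image] at hik
    obtain ⟨S, -, hS⟩ := hik
    have hBS := (hsel S).eq_true (hAB.exists_input S.2)
    rw [hS, hB] at hBS
    cases hBS
  exact hf.solvesP2 ⟨hNB, hf.structurallyControllable hA⟩ h.nnzCount_le fun S => (hsel S).cost_le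

end IsAlgorithmOutput

end GreedyAlgorithm

end StructuralControl

theorem mainTheorem1_general {d m : ℕ} (A : StructuralControl.Sparsity d d)
    (B : StructuralControl.Sparsity d m) (w : Matrix (Fin d) (Fin m) ℝ)
    (hAB : StructuralControl.StructurallyControllable A B)
    (hA : StructuralControl.HasPerfectMatching A) :
    (∃ Bstar, StructuralControl.IsAlgorithmOutput A B w Bstar) ∧
      ∀ Bstar, StructuralControl.IsAlgorithmOutput A B w Bstar →
        StructuralControl.StructurallyControllable A Bstar ∧
          StructuralControl.SolvesP2 A B w Bstar := by
  refine ⟨StructuralControl.exists_isAlgorithmOutput w hAB, fun Bstar h => ?_⟩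
  have hsolves := h.solvesP2 hAB hA
  have hctrl : StructuralControl.StructurallyControllable A Bstar := hsolves.1.1.2
  exact ⟨hctrl, hsolves⟩

theorem mainTheorem1 {d m : ℕ} (A : StructuralControl.Sparsity d d)
    (B : StructuralControl.Sparsity d m) (w : Matrix (Fin d) (Fin m) ℝ)
    (hw : ∀ i k, B i k = true → 0 ≤ w i k)
    (hAB : StructuralControl.StructurallyControllable A B)
    (hA : StructuralControl.HasPerfectMatching A) :
    (∃ Bstar, StructuralControl.IsAlgorithmOutput A B w Bstar) ∧
      ∀ Bstar, StructuralControl.IsAlgorithmOutput A B w Bstar →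
        StructuralControl.StructurallyControllable A Bstar ∧
          StructuralControl.SolvesP2 A B w Bstar :=
  mainTheorem1_general A B w hAB hA
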